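/- Let $E$ and $F$ be Banach spaces over $\mathbb K=\mathbb R$ or $\mathbb C$, and let $B(E,F)$ be the Banach space of bounded linear operators from $E$ to $F$. For $T\in B(E,F)$ write $N(T)$ for the kernel and $R(T)$ for the range of $T$; $\operatorname{codim}R(T)=\dim F/R(T)$. Call $T$ *double splitting* if $R(T)$ is closed and $N(T)$ and $R(T)$ have closed complements in $E$ and $F$ respectively, and *semi-Fredholm* if $R(T)$ is closed and $N(T)$ is finite-dimensional or $R(T)$ has finite codimension. For integers $k,m,n\ge 0$ let - $F_k=\{T\in B(E,F):\operatorname{rank}T=k\}$; - $\Phi_{m,n}=\{T\in B(E,F):\dim N(T)=m,\ \operatorname{codim}R(T)=n\}$; - $\Phi_{m,\infty}$ be the set of double splitting semi-Fredholm operators $T\in B(E,F)$ with $\dim N(T)=m$ and $\operatorname{codim}R(T)=\infty$; - $\Phi_{\infty,n}$ be the set of double splitting semi-Fredholm operators $T\in B(E,F)$ with $\dim N(T)=\infty$ and $\operatorname{codim}R(T)=n$. For $X\in B(E,F)$ put $M(X)=\{T\in B(E,F): T\,N(X)\subset R(X)\}$. A subset $S$ of a Banach space $G$ is a *smooth submanifold*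 of $G$ if for every $x\in S$ there are a decomposition $G=E_0\oplus E_1$ into closed subspaces and a $C^\infty$ diffeomorphism $\varphi$ from an open neighbourhood $U$ of $x$ in $G$ onto an open set $\varphi(U)\subset G$ such that $\varphi(S\cap U)=E_0\cap\varphi(U)$. The *tangent space* of $S$ at $x\in S$ is the set of all $\dot c(0)$, where $c:(-\varepsilon,\varepsilon)\to G$ ($\varepsilon>0$, real parameter) is a $C^1$ curve contained in $S$ with $c(0)=x$. **Theorem 4.2.** Let $S$ be any one of the classes $F_k$, $\Phi_{m,n}$, $\Phi_{m,\infty}$, $\Phi_{\infty,n}$ with $k,m,n\ge 0$ finite. Then $S$ is a smooth submanifold of $B(E,F)$, and for every $X\in S$ the tangent space of $S$ at $X$ is $M(X)$. -/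

import Mathlib

open scoped ContDiff

namespace OperatorClasses

section Submanifold

variable (𝕜 : Type*) [RCLike 𝕜] {G : Type*} [NormedAddCommGroup G] [NormedSpace 𝕜 G]

/-- `S` is a smooth (split) submanifold of the Banach space `G`: around each of its points there is
a smooth diffeomorphism `φ` between open subsets of `G` that carries the part of `S` in the domain
of `φ` onto an open subset of a closed complemented subspace `E₀` of `G`. The subspace may depend
on the point. -/
def IsSmoothSubmanifold (S : Set G) : Prop :=
  ∀ x ∈ S, ∃ (E₀ E₁ : Submodule 𝕜 G) (φ : OpenPartialHomeomorph G G),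
    IsClosed (E₀ : Set G) ∧ IsClosed (E₁ : Set G) ∧ IsCompl E₀ E₁ ∧
    x ∈ φ.source ∧
    ContDiffOn 𝕜 ∞ φ φ.source ∧ ContDiffOn 𝕜 ∞ φ.symm φ.target ∧
    φ '' (S ∩ φ.source) = (E₀ : Set G) ∩ φ.target

/-- The tangent space of `S` at `x`: the set of all velocities `c'(0)` of `C¹` curves
`c : (-ε, ε) → G` (with a real parameter) that lie in `S` and satisfy `c 0 = x`. -/
def tangentVectors (S : Set G) (x : G) : Set G :=
  letI : NormedSpace ℝ G := NormedSpace.restrictScalars ℝ 𝕜 G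
  {v | ∃ (ε : ℝ) (c : ℝ → G), 0 < ε ∧ ContDiffOn ℝ 1 c (Set.Ioo (-ε) ε) ∧
    (∀ t ∈ Set.Ioo (-ε) ε, c t ∈ S) ∧ c 0 = x ∧ HasDerivAt c v 0}

end Submanifold

section Operators

variable {𝕜 : Type*} [RCLike 𝕜] {E F : Type*}
  [NormedAddCommGroup E] [NormedSpace 𝕜 E] [NormedAddCommGroup F] [NormedSpace 𝕜 F]

/-- `A` is double splitting: its range is closed, and its kernel and its range have closed
complements. -/
def IsDoubleSplitting (A : E →L[𝕜] F) : Prop :=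
  IsClosed (A.range : Set F) ∧
  (∃ R' : Submodule 𝕜 E, IsClosed (R' : Set E) ∧ IsCompl A.ker R') ∧
  (∃ N' : Submodule 𝕜 F, IsClosed (N' : Set F) ∧ IsCompl A.range N')

/-- `A` is semi-Fredholm: its range is closed, and its kernel is finite-dimensional or its range
has finite codimension. -/
def IsSemiFredholm (A : E →L[𝕜] F) : Prop :=
  IsClosed (A.range : Set F) ∧
  (FiniteDimensional 𝕜 A.ker ∨ FiniteDimensional 𝕜 (F ⧸ A.range))

variable (𝕜 E F)

/-- `F_k`: the bounded operators of rank `k`. -/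
def rankClass (k : ℕ) : Set (E →L[𝕜] F) :=
  {T | Module.rank 𝕜 T.range = k}

/-- `Φ_{m,n}`: the bounded operators with `dim N(T) = m` and `codim R(T) = n`, both finite. -/
def PhiFinFin (m n : ℕ) : Set (E →L[𝕜] F) :=
  {T | Module.rank 𝕜 T.ker = m ∧ Module.rank 𝕜 (F ⧸ T.range) = n}

/-- `Φ_{m,∞}`: the double splitting semi-Fredholm operators with `dim N(T) = m` finite and
`codim R(T) = ∞`. -/
def PhiFinInf (m : ℕ) : Set (E →L[𝕜] F) :=
  {T | IsSemiFredholm T ∧ IsDoubleSplitting T ∧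
    Module.rank 𝕜 T.ker = m ∧ ¬ FiniteDimensional 𝕜 (F ⧸ T.range)}

/-- `Φ_{∞,n}`: the double splitting semi-Fredholm operators with `dim N(T) = ∞` and
`codim R(T) = n` finite. -/
def PhiInfFin (n : ℕ) : Set (E →L[𝕜] F) :=
  {T | IsSemiFredholm T ∧ IsDoubleSplitting T ∧
    ¬ FiniteDimensional 𝕜 T.ker ∧ Module.rank 𝕜 (F ⧸ T.range) = n}

variable {𝕜 E F}

/-- `M(X) = {T : T N(X) ⊂ R(X)}`, a linear subspace of `B(E, F)`. -/
def M (X : E →L[𝕜] F) : Submodule 𝕜 (E →L[𝕜] F) where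
  carrier := {T | ∀ x ∈ X.ker, T x ∈ X.range}
  zero_mem' := fun _ _ => X.range.zero_mem
  add_mem' := fun hS hT x hx => X.range.add_mem (hS x hx) (hT x hx)
  smul_mem' := fun a _ hT x hx => X.range.smul_mem a (hT x hx)

/-- `S` is a smooth submanifold of `B(E, F)` which is tangent to `M(X)` at each `X ∈ S`, that is,
its tangent space at `X` is `M(X)`. -/
def IsSmoothSubmanifoldTangentToM (S : Set (E →L[𝕜] F)) : Prop :=
  IsSmoothSubmanifold 𝕜 S ∧
    ∀ X ∈ S, tangentVectors 𝕜 S X = (M X : Set (E →L[𝕜] F))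

end Operators

end OperatorClasses

/-! Fix `X` in the class and a generalized inverse `Y`. Then `P = 1 - YX` projects onto `N(X)`, `Q =
1 - XY` projects along `R(X)`, and `M(X)` is the kernel of `T ↦ QTP`. For `T` near `X` the operator
`A = 1 + (T - X)Y` is invertible, and block elimination makes `T` equivalent to `X + C`, with `C = Q
A⁻¹ T P` the Schur complement (`exists_equiv_comp_schur`).

Each class is invariant under equivalence, so `T` belongs to it iff `X + C` does. The range of `X +
C` contains `R(X)` and its kernel lies in `N(X)`; a finite dimension or codimension fixed by the
class turns one inclusion into an equality, which forces `C = 0`. So near `X` the class is `{C = 0}`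
(`mem_iff_schur_eq_zero`). Adding a corner `QDP` to `T` keeps `A` and adds `QDP` to `C`; hence
replacing the corner `QTP` by `C` is a chart, and it flattens the class onto `M(X)`.

Along a curve in the class, `C = 0` gives `QvP = 0` in the limit. Conversely, `v` in `M(X)` is the
velocity of `(1 + t vY) X (1 + t YvP)`, which stays in the class for small `t`. -/

namespace OperatorClasses

open Filter Topology

/-! ### Generalized inverses and double splitting operators -/

section GeneralizedInverse

variable {𝕜 : Type*} [RCLike 𝕜] {E F : Type*}
  [NormedAddCommGroup E] [NormedSpace 𝕜 E] [NormedAddCommGroup F] [NormedSpace 𝕜 F]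

/-- `Y` is a reflexive generalized inverse of `X`: `X Y X = X` and `Y X Y = Y`. -/
structure IsGeneralizedInverse (X : E →L[𝕜] F) (Y : F →L[𝕜] E) : Prop where
  inner_left : ∀ x, X (Y (X x)) = X x
  inner_right : ∀ y, Y (X (Y y)) = Y y

/-- A bounded operator whose kernel and range have closed complements has a generalized inverse,
by the open mapping theorem. -/
theorem exists_isGeneralizedInverse [CompleteSpace E] [CompleteSpace F] (X : E →L[𝕜] F)
    {R : Submodule 𝕜 E} (hRc : IsClosed (R : Set E)) (hR : IsCompl X.ker R)
    {N : Submodule 𝕜 F} (hNc : IsClosed (N : Set F)) (hN : IsCompl X.range N) :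
    ∃ Y, IsGeneralizedInverse X Y := by
  have : CompleteSpace R := hRc.completeSpace_coe
  have : CompleteSpace N := hNc.completeSpace_coe
  -- `Y` will be the `R`-component of the inverse of this bijection: it inverts `X` on `R` and kills
  -- `N`.
  let f : (R × N) →L[𝕜] F := (X ∘L R.subtypeL).coprod N.subtypeL
  have hf : ∀ u w, f (u, w) = X (u : E) + (w : F) := fun u w => by simp [f]
  have hinj : f.ker = ⊥ := by
    rw [Submodule.eq_bot_iff]
    rintro ⟨u, w⟩ h
    have h0 : X (u : E) + (w : F) = 0 := by rw [← hf]; exact h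
    have hw : (w : F) = X (-(u : E)) := by
      rw [map_neg]; exact eq_neg_of_add_eq_zero_right h0
    have hw0 : (w : F) = 0 :=
      Submodule.disjoint_def.1 hN.disjoint _ (hw ▸ ⟨_, rfl⟩) w.2
    have hu0 : (u : E) = 0 :=
      Submodule.disjoint_def.1 hR.disjoint _ (by simpa [hw0] using h0) u.2
    exact Prod.ext (Subtype.ext hu0) (Subtype.ext hw0)
  have decomp : ∀ x : E, ∃ u : R, X (u : E) = X x := fun x => by
    obtain ⟨a, ha, b, hb, rfl⟩ := Submodule.mem_sup.1 (hR.sup_eq_top ▸ Submodule.mem_top (x := x))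
    exact ⟨⟨b, hb⟩, by simpa using ha⟩
  have hsurj : f.range = ⊤ := by
    rw [Submodule.eq_top_iff']
    intro y
    obtain ⟨_, ⟨x, rfl⟩, w, hw, rfl⟩ :=
      Submodule.mem_sup.1 (hN.sup_eq_top ▸ Submodule.mem_top (x := y))
    obtain ⟨u, hu⟩ := decomp x
    exact ⟨(u, ⟨w, hw⟩), by simpa [hu] using hf u ⟨w, hw⟩⟩
  let e := ContinuousLinearEquiv.ofBijective f hinj hsurj
  have he : ∀ u : R, e.symm (X (u : E)) = (u, 0) := fun u => by
    rw [ContinuousLinearEquiv.symm_apply_eq]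
    exact (by simpa using (hf u 0).symm : X (u : E) = f (u, 0))
  refine ⟨R.subtypeL ∘L ContinuousLinearMap.fst 𝕜 R N ∘L (e.symm : F →L[𝕜] R × N), ?_, ?_⟩
  · intro x
    obtain ⟨u, hu⟩ := decomp x
    simp [← hu, he]
  · intro y
    simp [he]

/-- A generalized inverse exhibits an operator as double splitting. -/
theorem IsGeneralizedInverse.isDoubleSplitting {X : E →L[𝕜] F} {Y : F →L[𝕜] E}
    (H : IsGeneralizedInverse X Y) : IsDoubleSplitting X := by
  have hrange : X.range = (ContinuousLinearMap.id 𝕜 F - X ∘L Y).ker := by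
    ext y
    constructor
    · rintro ⟨x, rfl⟩
      simp [H.inner_left]
    · intro h
      exact ⟨Y y, (sub_eq_zero.1 (by simpa using h)).symm⟩
  refine ⟨?_, ⟨(ContinuousLinearMap.id 𝕜 E - Y ∘L X).ker, ContinuousLinearMap.isClosed_ker _, ?_⟩,
    ⟨(X ∘L Y).ker, ContinuousLinearMap.isClosed_ker _, ?_⟩⟩
  · rw [hrange]
    exact ContinuousLinearMap.isClosed_ker _
  · refine IsCompl.of_eq ?_ ?_
    · rw [Submodule.eq_bot_iff]
      rintro x ⟨h1, h2⟩
      have h1' : X x = 0 := h1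
      have h2' : x - Y (X x) = 0 := h2
      simpa [h1'] using h2'
    · rw [Submodule.eq_top_iff']
      intro x
      refine Submodule.mem_sup.2 ⟨x - Y (X x), ?_, Y (X x), ?_, by simp⟩
      · simp [H.inner_left]
      · simp [H.inner_left]
  · refine IsCompl.of_eq ?_ ?_
    · rw [Submodule.eq_bot_iff]
      rintro y ⟨⟨x, rfl⟩, h2⟩
      have h2' : X (Y (X x)) = 0 := h2
      rwa [H.inner_left] at h2'
    · rw [Submodule.eq_top_iff']
      intro y
      exact Submodule.mem_sup.2 ⟨X (Y y), ⟨_, rfl⟩, y - X (Y y), by simp [H.inner_left], by simp⟩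

theorem isDoubleSplitting_iff [CompleteSpace E] [CompleteSpace F] {X : E →L[𝕜] F} :
    IsDoubleSplitting X ↔ ∃ Y, IsGeneralizedInverse X Y :=
  ⟨fun ⟨_, ⟨_, hRc, hR⟩, ⟨_, hNc, hN⟩⟩ => exists_isGeneralizedInverse X hRc hR hNc hN,
    fun ⟨_, H⟩ => H.isDoubleSplitting⟩

theorem IsGeneralizedInverse.equiv_comp {X : E →L[𝕜] F} {Y : F →L[𝕜] E}
    (H : IsGeneralizedInverse X Y) (A : F ≃L[𝕜] F) (B : E ≃L[𝕜] E) :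
    IsGeneralizedInverse ((A : F →L[𝕜] F) ∘L X ∘L (B : E →L[𝕜] E))
      ((B.symm : E →L[𝕜] E) ∘L Y ∘L (A.symm : F →L[𝕜] F)) :=
  ⟨fun x => by simp [H.inner_left], fun y => by simp [H.inner_right]⟩

end GeneralizedInverse

/-! ### Invariance of rank, nullity and corank under equivalence -/

section Equivalence

variable {𝕜 : Type*} [RCLike 𝕜] {E F : Type*}
  [NormedAddCommGroup E] [NormedSpace 𝕜 E] [NormedAddCommGroup F] [NormedSpace 𝕜 F]
  (A : F ≃L[𝕜] F) (B : E ≃L[𝕜] E) (T : E →L[𝕜] F)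

theorem range_equiv_comp : ((A : F →L[𝕜] F) ∘L T ∘L (B : E →L[𝕜] E)).range =
    T.range.map (A.toLinearEquiv : F →ₗ[𝕜] F) := by
  ext y
  constructor
  · rintro ⟨x, rfl⟩
    exact ⟨T (B x), ⟨_, rfl⟩, rfl⟩
  · rintro ⟨_, ⟨x, rfl⟩, rfl⟩
    exact ⟨B.symm x, by simp⟩

theorem ker_equiv_comp : ((A : F →L[𝕜] F) ∘L T ∘L (B : E →L[𝕜] E)).ker =
    T.ker.map (B.symm.toLinearEquiv : E →ₗ[𝕜] E) := by
  ext x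
  constructor
  · intro h
    exact ⟨B x, by simpa using h, by simp⟩
  · rintro ⟨x, h, rfl⟩
    have h' : T x = 0 := h
    simp [h']

theorem nonempty_range_equiv :
    Nonempty (T.range ≃ₗ[𝕜] ((A : F →L[𝕜] F) ∘L T ∘L (B : E →L[𝕜] E)).range) := by
  rw [range_equiv_comp]
  exact ⟨A.toLinearEquiv.submoduleMap _⟩

theorem nonempty_ker_equiv :
    Nonempty (T.ker ≃ₗ[𝕜] ((A : F →L[𝕜] F) ∘L T ∘L (B : E →L[𝕜] E)).ker) := by
  rw [ker_equiv_comp]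
  exact ⟨B.symm.toLinearEquiv.submoduleMap _⟩

theorem nonempty_quotient_range_equiv :
    Nonempty ((F ⧸ T.range) ≃ₗ[𝕜]
      (F ⧸ ((A : F →L[𝕜] F) ∘L T ∘L (B : E →L[𝕜] E)).range)) :=
  ⟨Submodule.Quotient.equiv _ _ A.toLinearEquiv (range_equiv_comp A B T).symm⟩

end Equivalence

/-! ### The Schur complement and the straightening chart -/

section Chart

variable {𝕜 : Type*} [RCLike 𝕜] {E F : Type*}
  [NormedAddCommGroup E] [NormedSpace 𝕜 E] [NormedAddCommGroup F] [NormedSpace 𝕜 F]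

/-- The projection `1 - Y X` onto the kernel of `X`. -/
def kerProj (X : E →L[𝕜] F) (Y : F →L[𝕜] E) : E →L[𝕜] E :=
  ContinuousLinearMap.id 𝕜 E - Y ∘L X

/-- The projection `1 - X Y` along the range of `X`. -/
def corangeProj (X : E →L[𝕜] F) (Y : F →L[𝕜] E) : F →L[𝕜] F :=
  ContinuousLinearMap.id 𝕜 F - X ∘L Y

/-- The operator `1 + (T - X) Y`, which equals the identity at `T = X`. -/
def shift (X : E →L[𝕜] F) (Y : F →L[𝕜] E) (T : E →L[𝕜] F) : F →L[𝕜] F :=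
  1 + (T - X) ∘L Y

/-- The Schur complement of `T` relative to the splittings of `E` and `F` given by `X` and `Y`. -/
noncomputable def schur (X : E →L[𝕜] F) (Y : F →L[𝕜] E) (T : E →L[𝕜] F) : E →L[𝕜] F :=
  corangeProj X Y ∘L Ring.inverse (shift X Y T) ∘L T ∘L kerProj X Y

/-- The difference between the corner `Q T P` of `T` and the Schur complement of `T`. -/
noncomputable def schurCorrection (X : E →L[𝕜] F) (Y : F →L[𝕜] E) (T : E →L[𝕜] F) : E →L[𝕜] F :=
  corangeProj X Y ∘L T ∘L kerProj X Y - schur X Y T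

@[simp] theorem kerProj_apply (X : E →L[𝕜] F) (Y : F →L[𝕜] E) (x : E) :
    kerProj X Y x = x - Y (X x) := rfl

@[simp] theorem corangeProj_apply (X : E →L[𝕜] F) (Y : F →L[𝕜] E) (y : F) :
    corangeProj X Y y = y - X (Y y) := rfl

@[simp] theorem shift_apply (X : E →L[𝕜] F) (Y : F →L[𝕜] E) (T : E →L[𝕜] F) (y : F) :
    shift X Y T y = y + (T (Y y) - X (Y y)) := rfl

theorem schur_apply (X : E →L[𝕜] F) (Y : F →L[𝕜] E) (T : E →L[𝕜] F) (x : E) :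
    schur X Y T x = corangeProj X Y (Ring.inverse (shift X Y T) (T (kerProj X Y x))) := rfl

theorem schurCorrection_apply (X : E →L[𝕜] F) (Y : F →L[𝕜] E) (T : E →L[𝕜] F) (x : E) :
    schurCorrection X Y T x = corangeProj X Y (T (kerProj X Y x)) - schur X Y T x := rfl

variable {X : E →L[𝕜] F} {Y : F →L[𝕜] E}

theorem shift_self : shift X Y X = 1 := by
  simp [shift]

theorem shift_inverse_apply {T : E →L[𝕜] F} (hT : IsUnit (shift X Y T)) (y : F) :
    shift X Y T (Ring.inverse (shift X Y T) y) = y :=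
  DFunLike.congr_fun (Ring.mul_inverse_cancel _ hT) y

theorem inverse_shift_apply {T : E →L[𝕜] F} (hT : IsUnit (shift X Y T)) (y : F) :
    Ring.inverse (shift X Y T) (shift X Y T y) = y :=
  DFunLike.congr_fun (Ring.inverse_mul_cancel _ hT) y

namespace IsGeneralizedInverse

/-- Since `P Y = 0`, composing with `Y` does not see the corner. -/
theorem shift_add (H : IsGeneralizedInverse X Y) (T D : E →L[𝕜] F) :
    shift X Y (T + corangeProj X Y ∘L D ∘L kerProj X Y) = shift X Y T := by
  ext y
  simp [H.inner_right]

/-- Since `Y Q = 0`, the shift fixes the range of `Q` pointwise, and so does its inverse. -/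
theorem inverse_shift_corangeProj (H : IsGeneralizedInverse X Y) {T : E →L[𝕜] F}
    (hT : IsUnit (shift X Y T)) (y : F) :
    Ring.inverse (shift X Y T) (corangeProj X Y y) = corangeProj X Y y := by
  conv_lhs => rw [show corangeProj X Y y = shift X Y T (corangeProj X Y y) by
    simp [H.inner_right]]
  exact inverse_shift_apply hT _

theorem schur_add (H : IsGeneralizedInverse X Y) {T : E →L[𝕜] F}
    (hT : IsUnit (shift X Y T)) (D : E →L[𝕜] F) :
    schur X Y (T + corangeProj X Y ∘L D ∘L kerProj X Y) =
      schur X Y T + corangeProj X Y ∘L D ∘L kerProj X Y := by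
  ext x
  rw [schur_apply, H.shift_add, add_apply, map_add, map_add,
    add_apply, schur_apply]
  congr 1
  rw [ContinuousLinearMap.comp_apply, ContinuousLinearMap.comp_apply,
    H.inverse_shift_corangeProj hT]
  simp [H.inner_left, H.inner_right]

/-- The corner and the Schur complement move by the same amount, so the correction ignores the
corner. This is why adding it back inverts the chart. -/
theorem schurCorrection_add (H : IsGeneralizedInverse X Y) {T : E →L[𝕜] F}
    (hT : IsUnit (shift X Y T)) (D : E →L[𝕜] F) :
    schurCorrection X Y (T + corangeProj X Y ∘L D ∘L kerProj X Y) = schurCorrection X Y T := by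
  rw [schurCorrection, H.schur_add hT, schurCorrection]
  ext x
  simp [H.inner_left, H.inner_right]

theorem corner_schurCorrection (H : IsGeneralizedInverse X Y) (T : E →L[𝕜] F) :
    corangeProj X Y ∘L schurCorrection X Y T ∘L kerProj X Y = schurCorrection X Y T := by
  ext x
  simp [schurCorrection_apply, schur_apply, H.inner_left, H.inner_right]

theorem shift_add_schurCorrection (H : IsGeneralizedInverse X Y) (T : E →L[𝕜] F) :
    shift X Y (T + schurCorrection X Y T) = shift X Y T := by
  conv_lhs => rw [← H.corner_schurCorrection T]
  exact H.shift_add _ _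

theorem shift_sub_schurCorrection (H : IsGeneralizedInverse X Y) (T : E →L[𝕜] F) :
    shift X Y (T - schurCorrection X Y T) = shift X Y T := by
  have h := H.shift_add (T - schurCorrection X Y T) (schurCorrection X Y T)
  rwa [H.corner_schurCorrection, sub_add_cancel, eq_comm] at h

theorem schurCorrection_add_self (H : IsGeneralizedInverse X Y) {T : E →L[𝕜] F}
    (hT : IsUnit (shift X Y T)) :
    schurCorrection X Y (T + schurCorrection X Y T) = schurCorrection X Y T := by
  have h := H.schurCorrection_add hT (schurCorrection X Y T)
  rwa [H.corner_schurCorrection] at h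

theorem schurCorrection_sub_self (H : IsGeneralizedInverse X Y) {T : E →L[𝕜] F}
    (hT : IsUnit (shift X Y T)) :
    schurCorrection X Y (T - schurCorrection X Y T) = schurCorrection X Y T := by
  have h := H.schurCorrection_add (T := T - schurCorrection X Y T)
    (by rwa [H.shift_sub_schurCorrection]) (schurCorrection X Y T)
  rwa [H.corner_schurCorrection, sub_add_cancel, eq_comm] at h

/-- The corner `Q φ(T) P` of the straightened operator `φ(T) = T - schurCorrection T` is the
Schur complement of `T`. -/
theorem corner_sub_schurCorrection (H : IsGeneralizedInverse X Y) (T : E →L[𝕜] F) :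
    corangeProj X Y ∘L (T - schurCorrection X Y T) ∘L kerProj X Y = schur X Y T := by
  rw [ContinuousLinearMap.sub_comp, ContinuousLinearMap.comp_sub, H.corner_schurCorrection,
    schurCorrection, sub_sub_cancel]

/-- Near `X` every operator is equivalent to the sum of `X` and its Schur complement. -/
theorem exists_equiv_comp_schur (H : IsGeneralizedInverse X Y) {T : E →L[𝕜] F}
    (hT : IsUnit (shift X Y T)) :
    ∃ (A : F ≃L[𝕜] F) (B : E ≃L[𝕜] E),
      T = (A : F →L[𝕜] F) ∘L (X + schur X Y T) ∘L (B : E →L[𝕜] E) := by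
  obtain ⟨u, hu⟩ := hT
  let W : E →L[𝕜] F := Ring.inverse (shift X Y T) ∘L T ∘L kerProj X Y
  have hW : ∀ x, W x = Ring.inverse (shift X Y T) (T (kerProj X Y x)) := fun _ => rfl
  have hWY : ∀ y, W (Y y) = 0 := fun y => by simp [hW, H.inner_right]
  have hs : ∀ x, schur X Y T x = W x - X (Y (W x)) := fun _ => rfl
  -- `W Y = 0` gives `(Y W)² = 0`, so `1 - Y W` inverts `1 + Y W`.
  let B : E ≃L[𝕜] E := ContinuousLinearEquiv.equivOfInverse
    (ContinuousLinearMap.id 𝕜 E + Y ∘L W) (ContinuousLinearMap.id 𝕜 E - Y ∘L W)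
    (fun x => by simp [hWY]) (fun x => by simp [hWY])
  have hB : ∀ x, B x = x + Y (W x) := fun _ => rfl
  refine ⟨ContinuousLinearEquiv.ofUnit u, B, ?_⟩
  ext x
  have hA : ∀ y, ContinuousLinearEquiv.ofUnit u y = shift X Y T y := fun y => by
    rw [← hu]; rfl
  have h1 : X (B x) + schur X Y T (B x) = X x + W x := by
    simp [hB, hs, hWY]
  change T x = ContinuousLinearEquiv.ofUnit u (X (B x) + schur X Y T (B x))
  -- With `A` the shift, `A X = T Y X` and `A W = T P`, and these add up to `T`.
  rw [h1, hA, map_add, hW, shift_inverse_apply ⟨u, hu⟩]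
  simp [H.inner_left]

theorem corner_eq_zero_iff (H : IsGeneralizedInverse X Y) {T : E →L[𝕜] F} :
    corangeProj X Y ∘L T ∘L kerProj X Y = 0 ↔ T ∈ M X := by
  constructor
  · intro h x hx
    have hx' : X x = 0 := hx
    have h1 := DFunLike.congr_fun h x
    simp only [ContinuousLinearMap.comp_apply, kerProj_apply, corangeProj_apply, hx', map_zero,
      sub_zero, zero_apply] at h1
    exact ⟨Y (T x), (sub_eq_zero.1 h1).symm⟩
  · intro h
    ext x
    obtain ⟨z, hz⟩ := h (kerProj X Y x) (by simp [H.inner_left])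
    have hz' : X z = T (kerProj X Y x) := hz
    rw [ContinuousLinearMap.comp_apply, ContinuousLinearMap.comp_apply, ← hz']
    simp [H.inner_left]

theorem exists_compl_M (H : IsGeneralizedInverse X Y) :
    ∃ E₁ : Submodule 𝕜 (E →L[𝕜] F), IsClosed ((M X : Submodule 𝕜 (E →L[𝕜] F)) : Set (E →L[𝕜] F)) ∧
      IsClosed (E₁ : Set (E →L[𝕜] F)) ∧ IsCompl (M X) E₁ := by
  let p : (E →L[𝕜] F) →ₗ[𝕜] (E →L[𝕜] F) :=
    { toFun := fun T => corangeProj X Y ∘L T ∘L kerProj X Y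
      map_add' := fun S T => by ext x; simp only [ContinuousLinearMap.comp_apply,
        add_apply, map_add]
      map_smul' := fun a T => by ext x; simp only [ContinuousLinearMap.comp_apply,
        smul_apply, map_smul, RingHom.id_apply] }
  have hp : ∀ T, p T = corangeProj X Y ∘L T ∘L kerProj X Y := fun _ => rfl
  have hpp : ∀ T, p (p T) = p T := fun T => by
    ext x
    simp [hp, H.inner_left, H.inner_right]
  have hpc : Continuous p := by
    change Continuous fun T => corangeProj X Y ∘L T ∘L kerProj X Y
    fun_prop
  have hM : ∀ T, T ∈ M X ↔ p T = 0 := fun T => H.corner_eq_zero_iff.symm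
  -- The kernel of `1 - p` is the range of the projection `p`, while `M X` is the kernel of `p`.
  refine ⟨LinearMap.ker (LinearMap.id - p), ?_, ?_, IsCompl.of_eq ?_ ?_⟩
  · rw [show ((M X : Submodule 𝕜 (E →L[𝕜] F)) : Set (E →L[𝕜] F)) = p ⁻¹' {0} from
      Set.ext fun T => hM T]
    exact isClosed_singleton.preimage hpc
  · exact isClosed_singleton.preimage (continuous_id.sub hpc)
  · rw [Submodule.eq_bot_iff]
    rintro T ⟨h1, h2⟩
    have h1' := (hM T).1 h1
    have h2' : T - p T = 0 := h2
    rwa [h1', sub_zero] at h2'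
  · rw [Submodule.eq_top_iff']
    intro T
    refine Submodule.mem_sup.2 ⟨T - p T, ?_, p T, ?_, by simp⟩
    · rw [hM, map_sub, hpp, sub_self]
    · change p T - p (p T) = 0
      rw [hpp, sub_self]

theorem isOpen_isUnit_shift [CompleteSpace F] (X : E →L[𝕜] F) (Y : F →L[𝕜] E) :
    IsOpen {T : E →L[𝕜] F | IsUnit (shift X Y T)} := by
  refine Units.isOpen.preimage (f := shift X Y) ?_
  unfold shift
  fun_prop

theorem contDiffOn_schurCorrection [CompleteSpace F] (X : E →L[𝕜] F) (Y : F →L[𝕜] E) :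
    ContDiffOn 𝕜 ∞ (schurCorrection X Y) {T : E →L[𝕜] F | IsUnit (shift X Y T)} := by
  intro T hT
  obtain ⟨u, hu⟩ := hT
  have h1 : ContDiffAt 𝕜 ∞ (shift X Y) T := by
    unfold shift
    exact contDiffAt_const.add ((contDiffAt_id.sub contDiffAt_const).clm_comp contDiffAt_const)
  have h2 : ContDiffAt 𝕜 ∞ (fun T => Ring.inverse (shift X Y T)) T :=
    ContDiffAt.comp (g := Ring.inverse) T (hu ▸ contDiffAt_ringInverse 𝕜 u) h1
  have h3 : ContDiffAt 𝕜 ∞ (fun T : E →L[𝕜] F => T ∘L kerProj X Y) T :=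
    contDiffAt_id.clm_comp contDiffAt_const
  exact ((contDiffAt_const.clm_comp h3).sub
    (contDiffAt_const.clm_comp (h2.clm_comp h3))).contDiffWithinAt

/-- The chart `T ↦ T - schurCorrection T`, which replaces the corner `Q T P` of `T` by the Schur
complement of `T`. -/
noncomputable def chart [CompleteSpace F] (H : IsGeneralizedInverse X Y) :
    OpenPartialHomeomorph (E →L[𝕜] F) (E →L[𝕜] F) where
  toFun T := T - schurCorrection X Y T
  invFun T := T + schurCorrection X Y T
  source := {T | IsUnit (shift X Y T)}
  target := {T | IsUnit (shift X Y T)}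
  map_source' T hT := by rwa [Set.mem_ofPred_eq, H.shift_sub_schurCorrection]
  map_target' T hT := by rwa [Set.mem_ofPred_eq, H.shift_add_schurCorrection]
  left_inv' T hT := by rw [H.schurCorrection_sub_self hT, sub_add_cancel]
  right_inv' T hT := by rw [H.schurCorrection_add_self hT, add_sub_cancel_right]
  open_source := isOpen_isUnit_shift X Y
  open_target := isOpen_isUnit_shift X Y
  continuousOn_toFun := continuousOn_id.sub (contDiffOn_schurCorrection X Y).continuousOn
  continuousOn_invFun := continuousOn_id.add (contDiffOn_schurCorrection X Y).continuousOn

end IsGeneralizedInverse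

end Chart

theorem quadratic_curve {G : Type*} [NormedAddCommGroup G] [NormedSpace ℝ G] (x v w : G) :
    ContDiff ℝ 1 (fun t : ℝ => x + t • v + t ^ 2 • w) ∧
      x + (0 : ℝ) • v + (0 : ℝ) ^ 2 • w = x ∧
      HasDerivAt (fun t : ℝ => x + t • v + t ^ 2 • w) v 0 := by
  refine ⟨by fun_prop, by simp, ?_⟩
  have h1 : HasDerivAt (fun t : ℝ => x + t • v) ((1 : ℝ) • v) 0 :=
    ((hasDerivAt_id (0 : ℝ)).smul_const v).const_add x
  have h2 := (hasDerivAt_pow 2 (0 : ℝ)).smul_const w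
  simpa using h1.fun_add h2

/-! ### Rigid classes: local equation, submanifold property and tangent space -/

section OperatorClass

variable {𝕜 : Type*} [RCLike 𝕜] {E F : Type*}
  [NormedAddCommGroup E] [NormedSpace 𝕜 E] [NormedAddCommGroup F] [NormedSpace 𝕜 F]

/-- A class of operators which admit generalized inverses, is invariant under equivalence, and in
which enlarging the range and shrinking the kernel changes at most one of the two. -/
structure IsRigidClass (S : Set (E →L[𝕜] F)) : Prop where
  exists_inverse : ∀ X ∈ S, ∃ Y, IsGeneralizedInverse X Y
  equiv_comp_mem : ∀ T ∈ S, ∀ (A : F ≃L[𝕜] F) (B : E ≃L[𝕜] E),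
    (A : F →L[𝕜] F) ∘L T ∘L (B : E →L[𝕜] E) ∈ S
  ker_eq_or_range_eq : ∀ X ∈ S, ∀ Z ∈ S, Z.ker ≤ X.ker → X.range ≤ Z.range →
    Z.ker = X.ker ∨ Z.range = X.range

namespace IsRigidClass

variable {S : Set (E →L[𝕜] F)} {X : E →L[𝕜] F} {Y : F →L[𝕜] E}

theorem mem_iff_schur_eq_zero (hS : IsRigidClass S) (hX : X ∈ S) (H : IsGeneralizedInverse X Y)
    {T : E →L[𝕜] F} (hT : IsUnit (shift X Y T)) : T ∈ S ↔ schur X Y T = 0 := by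
  obtain ⟨A, B, hAB⟩ := H.exists_equiv_comp_schur hT
  constructor
  · intro hTS
    have hs : ∀ x, schur X Y T x =
        corangeProj X Y (Ring.inverse (shift X Y T) (T (kerProj X Y x))) := fun _ => rfl
    have hZ : X + schur X Y T ∈ S := by
      convert hS.equiv_comp_mem T hTS A.symm B.symm using 1
      ext x
      conv_rhs => rw [hAB]
      simp
    have hXY : ∀ x, X (Y (X x + schur X Y T x)) = X x := fun x => by
      simp [hs, H.inner_left, H.inner_right]
    have hker : (X + schur X Y T).ker ≤ X.ker := fun x hx => by
      have hx' : X x + schur X Y T x = 0 := hx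
      have h := hXY x
      rw [hx', map_zero, map_zero] at h
      exact h.symm
    have hrange : X.range ≤ (X + schur X Y T).range := by
      rintro _ ⟨x, rfl⟩
      exact ⟨Y (X x), by simp [hs, H.inner_left]⟩
    -- Equal kernels: `C` vanishes on `N(X)` and `C = C P`. Equal ranges: `C` maps into `R(X)`,
    -- which `X Y` fixes, yet `X Y C = 0`.
    rcases hS.ker_eq_or_range_eq X hX _ hZ hker hrange with h | h
    · ext x
      have hx : kerProj X Y x ∈ (X + schur X Y T).ker := by
        rw [h]
        simp [H.inner_left]
      have hx' : X (kerProj X Y x) + schur X Y T (kerProj X Y x) = 0 := hx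
      simpa [hs, H.inner_left, H.inner_right] using hx'
    · ext x
      have hx : X x + schur X Y T x ∈ X.range := by
        rw [← h]
        exact ⟨x, rfl⟩
      obtain ⟨z, hz⟩ := hx
      have hz' : X z = X x + schur X Y T x := hz
      have h1 := hXY x
      rw [← hz', H.inner_left, hz'] at h1
      simpa using h1
  · intro h
    rw [hAB, h, add_zero]
    exact hS.equiv_comp_mem X hX A B

theorem isSmoothSubmanifold [CompleteSpace F] (hS : IsRigidClass S) :
    IsSmoothSubmanifold 𝕜 S := by
  intro X hX
  obtain ⟨Y, H⟩ := hS.exists_inverse X hX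
  obtain ⟨E₁, h0, h1, h01⟩ := H.exists_compl_M
  have hsmooth := IsGeneralizedInverse.contDiffOn_schurCorrection X Y
  refine ⟨M X, E₁, H.chart, h0, h1, h01, ?_, contDiffOn_id.sub hsmooth,
    contDiffOn_id.add hsmooth, ?_⟩
  · change IsUnit (shift X Y X)
    rw [shift_self]
    exact isUnit_one
  · ext Z
    constructor
    · rintro ⟨T, ⟨hTS, hT⟩, rfl⟩
      refine ⟨?_, H.chart.map_source hT⟩
      rw [SetLike.mem_coe, ← H.corner_eq_zero_iff]
      exact (H.corner_sub_schurCorrection T).trans ((hS.mem_iff_schur_eq_zero hX H hT).1 hTS)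
    · rintro ⟨hZM, hZ⟩
      have hT := H.chart.map_target hZ
      refine ⟨H.chart.symm Z, ⟨?_, hT⟩, H.chart.right_inv hZ⟩
      rw [hS.mem_iff_schur_eq_zero hX H hT, ← H.corner_sub_schurCorrection]
      have h := H.chart.right_inv hZ
      change H.chart.symm Z - schurCorrection X Y (H.chart.symm Z) = Z at h
      rw [h]
      exact H.corner_eq_zero_iff.2 hZM

/-- A limit of rescaled differences `a (c - X)`, where `c` lies in the class and tends to `X`,
belongs to `M X`. -/
theorem mem_M_of_tendsto [CompleteSpace F] (hS : IsRigidClass S) (hX : X ∈ S) {ι : Type*}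
    {l : Filter ι} [l.NeBot] {c : ι → E →L[𝕜] F} {a : ι → 𝕜} {v : E →L[𝕜] F}
    (hcS : ∀ᶠ t in l, c t ∈ S) (hc : Tendsto c l (𝓝 X))
    (hv : Tendsto (fun t => a t • (c t - X)) l (𝓝 v)) : v ∈ M X := by
  obtain ⟨Y, H⟩ := hS.exists_inverse X hX
  have hshift : Continuous (shift X Y) := by
    unfold shift
    fun_prop
  have hinv : Tendsto (fun t => Ring.inverse (shift X Y (c t))) l (𝓝 1) := by
    have h1 : Tendsto (fun t => shift X Y (c t)) l (𝓝 1) := by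
      have h := (hshift.tendsto X).comp hc
      rwa [shift_self] at h
    have h2 := (NormedRing.inverse_continuousAt (1 : (F →L[𝕜] F)ˣ)).tendsto
    rw [Units.val_one, Ring.inverse_one] at h2
    exact h2.comp h1
  have hcont : Continuous fun p : (F →L[𝕜] F) × (E →L[𝕜] F) =>
      corangeProj X Y ∘L p.1 ∘L p.2 ∘L kerProj X Y := by fun_prop
  have hlim := (hcont.tendsto (1, v)).comp (hinv.prodMk_nhds hv)
  have hX1 : IsUnit (shift X Y X) := by
    rw [shift_self]
    exact isUnit_one
  -- The Schur complement of `c t` vanishes and `X P = 0`, so subtracting `X` and rescaling change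
  -- nothing.
  have hzero : ∀ᶠ t in l, corangeProj X Y ∘L Ring.inverse (shift X Y (c t)) ∘L
      (a t • (c t - X)) ∘L kerProj X Y = 0 := by
    filter_upwards [hc ((IsGeneralizedInverse.isOpen_isUnit_shift X Y).mem_nhds hX1), hcS]
      with t ht htS
    ext x
    have hx := DFunLike.congr_fun ((hS.mem_iff_schur_eq_zero hX H ht).1 htS) x
    rw [schur_apply, zero_apply] at hx
    have hker : X (kerProj X Y x) = 0 := by simp [H.inner_left]
    simp only [ContinuousLinearMap.comp_apply, smul_apply, sub_apply, hker, sub_zero, map_smul, hx,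
      smul_zero, zero_apply]
  exact H.corner_eq_zero_iff.1
    (tendsto_nhds_unique hlim (tendsto_const_nhds.congr' (hzero.mono fun _ h => h.symm)))

theorem tangentVectors_subset [CompleteSpace F] (hS : IsRigidClass S) (hX : X ∈ S) :
    tangentVectors 𝕜 S X ⊆ M X := by
  let _ : NormedSpace ℝ (E →L[𝕜] F) := NormedSpace.restrictScalars ℝ 𝕜 (E →L[𝕜] F)
  rintro v ⟨ε, c, hε, -, hcS, hc0, hv⟩
  refine hS.mem_M_of_tendsto hX (l := 𝓝[≠] (0 : ℝ)) (c := c)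
    (a := fun t => algebraMap ℝ 𝕜 t⁻¹) ?_ ?_ ?_
  · filter_upwards [mem_nhdsWithin_of_mem_nhds (Ioo_mem_nhds (neg_lt_zero.2 hε) hε)] with t ht
    exact hcS t ht
  · exact hc0 ▸ hv.continuousAt.tendsto.mono_left inf_le_left
  · have h := hasDerivAt_iff_tendsto_slope_zero.1 hv
    simp only [zero_add, hc0] at h
    exact h

theorem subset_tangentVectors [CompleteSpace E] [CompleteSpace F] (hS : IsRigidClass S)
    (hX : X ∈ S) : (M X : Set (E →L[𝕜] F)) ⊆ tangentVectors 𝕜 S X := by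
  obtain ⟨Y, H⟩ := hS.exists_inverse X hX
  intro v hv
  let _ : NormedSpace ℝ (E →L[𝕜] F) := NormedSpace.restrictScalars ℝ 𝕜 (E →L[𝕜] F)
  -- The curve is `(1 + tα) X (1 + tβ)`; its linear coefficient `αX + Xβ = vYX + XYvP` equals `v`
  -- because `QvP = 0`.
  let α : F →L[𝕜] F := v ∘L Y
  let β : E →L[𝕜] E := Y ∘L v ∘L kerProj X Y
  have hα : ∀ᶠ t : ℝ in 𝓝 0, IsUnit (1 + (t : 𝕜) • α) := by
    have hcont : Continuous fun t : ℝ => 1 + (t : 𝕜) • α := by fun_prop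
    exact hcont.continuousAt (Units.isOpen.mem_nhds (by simp))
  have hβ : ∀ᶠ t : ℝ in 𝓝 0, IsUnit (1 + (t : 𝕜) • β) := by
    have hcont : Continuous fun t : ℝ => 1 + (t : 𝕜) • β := by fun_prop
    exact hcont.continuousAt (Units.isOpen.mem_nhds (by simp))
  obtain ⟨ε, hε, hball⟩ := Metric.eventually_nhds_iff.1 (hα.and hβ)
  have hsplit : ∀ x, v (Y (X x)) + X (Y (v (kerProj X Y x))) = v x := fun x => by
    have h := DFunLike.congr_fun (H.corner_eq_zero_iff.2 hv) x
    have h' : v (kerProj X Y x) - X (Y (v (kerProj X Y x))) = 0 := h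
    rw [← sub_eq_zero.1 h']
    simp
  obtain ⟨hc1, hc0, hcv⟩ := quadratic_curve X v (α ∘L X ∘L β)
  refine ⟨ε, fun t => X + t • v + t ^ 2 • (α ∘L X ∘L β), hε, hc1.contDiffOn, ?_, hc0, hcv⟩
  · intro t ht
    obtain ⟨⟨a, ha⟩, b, hb⟩ := hball (y := t) (by
      rw [Real.dist_eq, sub_zero]
      exact abs_lt.2 ht)
    have h := hS.equiv_comp_mem X hX (ContinuousLinearEquiv.ofUnit a)
      (ContinuousLinearEquiv.ofUnit b)
    convert h using 1
    ext x
    change X x + (algebraMap ℝ 𝕜 t) • v x + (algebraMap ℝ 𝕜 (t ^ 2)) • (α (X (β x))) =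
      (a : F →L[𝕜] F) (X ((b : E →L[𝕜] E) x))
    rw [ha, hb, ← hsplit x]
    have hαx : ∀ y, α y = v (Y y) := fun _ => rfl
    have hβx : ∀ y, β y = Y (v (kerProj X Y y)) := fun _ => rfl
    simp only [RCLike.algebraMap_eq_ofReal, add_apply,
      one_apply_eq_self, smul_apply, map_add, map_smul, hαx, hβx]
    push_cast
    module

theorem isSmoothSubmanifoldTangentToM [CompleteSpace E] [CompleteSpace F] (hS : IsRigidClass S) :
    IsSmoothSubmanifoldTangentToM S :=
  ⟨hS.isSmoothSubmanifold, fun _ hX =>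
    (hS.tangentVectors_subset hX).antisymm (hS.subset_tangentVectors hX)⟩

end IsRigidClass

/-! ### Dimension counts and rigidity of the four classes -/

theorem finiteDimensional_of_rank_eq_nat {V : Type*} [AddCommGroup V] [Module 𝕜 V] {n : ℕ}
    (h : Module.rank 𝕜 V = n) : FiniteDimensional 𝕜 V :=
  Module.rank_lt_aleph0_iff.1 (h ▸ Cardinal.natCast_lt_aleph0)

theorem submodule_eq_of_le_of_rank_eq_nat {V : Type*} [AddCommGroup V] [Module 𝕜 V]
    {p q : Submodule 𝕜 V} {n : ℕ} (hle : p ≤ q) (hp : Module.rank 𝕜 p = n)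
    (hq : Module.rank 𝕜 q = n) : p = q := by
  have := finiteDimensional_of_rank_eq_nat hq
  exact Submodule.eq_of_le_of_finrank_eq hle
    ((Module.finrank_eq_of_rank_eq hp).trans (Module.finrank_eq_of_rank_eq hq).symm)

/-- The surjection `V ⧸ p → V ⧸ q` between spaces of equal finite dimension is injective. -/
theorem submodule_eq_of_le_of_rank_quotient_eq_nat {V : Type*} [AddCommGroup V] [Module 𝕜 V]
    {p q : Submodule 𝕜 V} {n : ℕ} (hle : p ≤ q) (hp : Module.rank 𝕜 (V ⧸ p) = n)
    (hq : Module.rank 𝕜 (V ⧸ q) = n) : p = q := by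
  have := finiteDimensional_of_rank_eq_nat hp
  have := finiteDimensional_of_rank_eq_nat hq
  have hfin : Module.finrank 𝕜 (V ⧸ p) = Module.finrank 𝕜 (V ⧸ q) :=
    (Module.finrank_eq_of_rank_eq hp).trans (Module.finrank_eq_of_rank_eq hq).symm
  have hinj : Function.Injective (Submodule.factor hle) :=
    (LinearMap.injective_iff_surjective_of_finrank_eq_finrank hfin).2
      (Submodule.factor_surjective hle)
  refine le_antisymm hle fun x hx => ?_
  rw [← Submodule.Quotient.mk_eq_zero] at hx ⊢
  exact hinj (by simpa using hx)

theorem isRigidClass_rankClass [CompleteSpace E] [CompleteSpace F] (k : ℕ) :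
    IsRigidClass (rankClass 𝕜 E F k) where
  exists_inverse X hX := by
    have : FiniteDimensional 𝕜 X.range := finiteDimensional_of_rank_eq_nat hX
    have : FiniteDimensional 𝕜 (E ⧸ X.ker) :=
      (X : E →ₗ[𝕜] F).quotKerEquivRange.symm.finiteDimensional
    obtain ⟨R, hRc, hR⟩ := (Submodule.ClosedComplemented.of_finiteDimensional_quotient
      (ContinuousLinearMap.isClosed_ker X)).exists_isClosed_isCompl
    obtain ⟨N, hNc, hN⟩ :=
      (Submodule.ClosedComplemented.of_finiteDimensional X.range).exists_isClosed_isCompl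
    exact exists_isGeneralizedInverse X hRc hR hNc hN
  equiv_comp_mem T hT A B := by
    obtain ⟨e⟩ := nonempty_range_equiv A B T
    exact e.rank_eq.symm.trans hT
  ker_eq_or_range_eq X hX Z hZ _ hrange :=
    .inr (submodule_eq_of_le_of_rank_eq_nat hrange hX hZ).symm

theorem isRigidClass_PhiFinFin [CompleteSpace E] [CompleteSpace F] (m n : ℕ) :
    IsRigidClass (PhiFinFin 𝕜 E F m n) where
  exists_inverse X hX := by
    have : FiniteDimensional 𝕜 X.ker := finiteDimensional_of_rank_eq_nat hX.1
    have : FiniteDimensional 𝕜 (F ⧸ X.range) := finiteDimensional_of_rank_eq_nat hX.2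
    obtain ⟨R, hRc, hR⟩ :=
      (Submodule.ClosedComplemented.of_finiteDimensional X.ker).exists_isClosed_isCompl
    -- An algebraic complement suffices: it is finite-dimensional, hence closed. Closedness of the
    -- range is not needed to build the generalized inverse.
    obtain ⟨N, hN⟩ := Submodule.exists_isCompl X.range
    have : FiniteDimensional 𝕜 N :=
      (Submodule.quotientEquivOfIsCompl _ _ hN).finiteDimensional
    exact exists_isGeneralizedInverse X hRc hR N.closed_of_finiteDimensional hN
  equiv_comp_mem T hT A B := by
    obtain ⟨e⟩ := nonempty_ker_equiv A B T
    obtain ⟨f⟩ := nonempty_quotient_range_equiv A B T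
    exact ⟨e.rank_eq.symm.trans hT.1, f.rank_eq.symm.trans hT.2⟩
  ker_eq_or_range_eq X hX Z hZ hker _ :=
    .inl (submodule_eq_of_le_of_rank_eq_nat hker hZ.1 hX.1)

theorem isRigidClass_PhiFinInf [CompleteSpace E] [CompleteSpace F] (m : ℕ) :
    IsRigidClass (PhiFinInf 𝕜 E F m) where
  exists_inverse X hX := isDoubleSplitting_iff.1 hX.2.1
  equiv_comp_mem T hT A B := by
    obtain ⟨e⟩ := nonempty_ker_equiv A B T
    obtain ⟨f⟩ := nonempty_quotient_range_equiv A B T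
    obtain ⟨-, hds, hker, hcoker⟩ := hT
    obtain ⟨Y, H⟩ := isDoubleSplitting_iff.1 hds
    have hds' := (H.equiv_comp A B).isDoubleSplitting
    have hker' := e.rank_eq.symm.trans hker
    exact ⟨⟨hds'.1, .inl (finiteDimensional_of_rank_eq_nat hker')⟩, hds', hker',
      fun _ => hcoker f.symm.finiteDimensional⟩
  ker_eq_or_range_eq X hX Z hZ hker _ :=
    .inl (submodule_eq_of_le_of_rank_eq_nat hker hZ.2.2.1 hX.2.2.1)

theorem isRigidClass_PhiInfFin [CompleteSpace E] [CompleteSpace F] (n : ℕ) :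
    IsRigidClass (PhiInfFin 𝕜 E F n) where
  exists_inverse X hX := isDoubleSplitting_iff.1 hX.2.1
  equiv_comp_mem T hT A B := by
    obtain ⟨e⟩ := nonempty_ker_equiv A B T
    obtain ⟨f⟩ := nonempty_quotient_range_equiv A B T
    obtain ⟨-, hds, hker, hcoker⟩ := hT
    obtain ⟨Y, H⟩ := isDoubleSplitting_iff.1 hds
    have hds' := (H.equiv_comp A B).isDoubleSplitting
    have hcoker' := f.rank_eq.symm.trans hcoker
    exact ⟨⟨hds'.1, .inr (finiteDimensional_of_rank_eq_nat hcoker')⟩, hds',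
      fun _ => hker e.symm.finiteDimensional, hcoker'⟩
  ker_eq_or_range_eq X hX Z hZ _ hrange :=
    .inr (submodule_eq_of_le_of_rank_quotient_eq_nat hrange hX.2.2.2 hZ.2.2.2).symm

end OperatorClass

end OperatorClasses

theorem theorem4p2 {𝕜 : Type*} [RCLike 𝕜]
    {E F : Type*} [NormedAddCommGroup E] [NormedSpace 𝕜 E] [CompleteSpace E]
    [NormedAddCommGroup F] [NormedSpace 𝕜 F] [CompleteSpace F] :
    (∀ k : ℕ, OperatorClasses.IsSmoothSubmanifoldTangentToM
      (OperatorClasses.rankClass 𝕜 E F k)) ∧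
    (∀ m n : ℕ, OperatorClasses.IsSmoothSubmanifoldTangentToM
      (OperatorClasses.PhiFinFin 𝕜 E F m n)) ∧
    (∀ m : ℕ, OperatorClasses.IsSmoothSubmanifoldTangentToM
      (OperatorClasses.PhiFinInf 𝕜 E F m)) ∧
    (∀ n : ℕ, OperatorClasses.IsSmoothSubmanifoldTangentToM
      (OperatorClasses.PhiInfFin 𝕜 E F n)) :=
  ⟨fun k => (OperatorClasses.isRigidClass_rankClass k).isSmoothSubmanifoldTangentToM,
    fun m n => (OperatorClasses.isRigidClass_PhiFinFin m n).isSmoothSubmanifoldTangentToM,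
    fun m => (OperatorClasses.isRigidClass_PhiFinInf m).isSmoothSubmanifoldTangentToM,
    fun n => (OperatorClasses.isRigidClass_PhiInfFin n).isSmoothSubmanifoldTangentToM⟩
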